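/- For a real $n\times k$ matrix $A$ with columns $\boldsymbol a_1,\dots,\boldsymbol a_k$, let $\mathcal Z(A)=\{\sum_i t_i\boldsymbol a_i \mid 0\le t_i\le 1\}\subset\mathbb R^n$ be the zonotope generated by the columns of $A$. The faces of a polytope are the empty set and the sets of maximizers of linear functionals on it (so the polytope itself is a face); ordered by inclusion they form its face lattice. A facet is a face of dimension one less than the polytope. Two subsets of $\mathbb R^n$ are congruent if an isometry of $\mathbb R^n$ maps one onto the other. **Proposition 3.8.** Let $A\in\mathbb R^{n\times k}$ and $B\in\mathbb R^{n\times l}$, let $\operatorname{rank}A\ge 3$ (so $\mathcal Z(A)$ has dimension at least $3$), and let $\varphi$ be an isomorphism from the face lattice of $\mathcal Z(A)$ to the face lattice of $\mathcal Z(B)$. Suppose that corresponding facets are congruent, compatibly with $\varphi$: for every facet $F$ of $\mathcal Z(A)$ there is an isometry of $\mathbb R^n$ that maps $F$ onto $\varphi(F)$ and, more precisely, maps every face $G\subseteq F$ of $\mathcal Z(A)$ onto the face $\varphi(G)$. Then $\mathcal Z(A)$ and $\mathcal Z(B)$ are congruent. -/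

import Mathlib

/-- The zonotope `𝒵(A) = {∑ tᵢ aᵢ | 0 ≤ tᵢ ≤ 1}` in `ℝⁿ` generated by the columns `aᵢ` of the
real `n × k` matrix `A`, i.e. the image of the unit cube of `ℝᵏ` under `A`. -/
def zonotope {n k : ℕ} (A : Matrix (Fin n) (Fin k) ℝ) : Set (EuclideanSpace ℝ (Fin n)) :=
  {x | ∃ t : Fin k → ℝ, (∀ i, 0 ≤ t i ∧ t i ≤ 1) ∧ x = ∑ i, t i • WithLp.toLp 2 (A.col i)}

/-- The faces of a polytope `P`: the empty set and the sets of maximizers on `P` of linear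
functionals (the zero functional gives `P` itself). As a subtype of `Set _` it is ordered by
inclusion, so this is the face lattice of `P`. -/
abbrev Face {n : ℕ} (P : Set (EuclideanSpace ℝ (Fin n))) : Type :=
  {F : Set (EuclideanSpace ℝ (Fin n)) // IsExposed ℝ P F}

/-- The dimension of a (nonempty) set: the dimension of its affine span. -/
noncomputable def affDim {n : ℕ} (S : Set (EuclideanSpace ℝ (Fin n))) : ℕ :=
  Module.finrank ℝ (vectorSpan ℝ S)

/-- A facet of `P` is a nonempty face whose dimension is one less than the dimension of `P`. -/
def IsFacet {n : ℕ} {P : Set (EuclideanSpace ℝ (Fin n))} (F : Face P) : Prop :=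
  F.1.Nonempty ∧ affDim F.1 + 1 = affDim P

/-- Two subsets of `ℝⁿ` are congruent if a Euclidean isometry of `ℝⁿ` (possibly
orientation-reversing) maps one onto the other. -/
def CongruentSets {n : ℕ} (S T : Set (EuclideanSpace ℝ (Fin n))) : Prop :=
  ∃ e : EuclideanSpace ℝ (Fin n) ≃ᵃⁱ[ℝ] EuclideanSpace ℝ (Fin n), e '' S = T

/-- Let `φ` be a combinatorial equivalence (isomorphism of face lattices) from `P` to `Q`, and `F`
a face of `P`. The corresponding faces `F` and `φ F` are congruent as corresponding faces: some
isometry maps `F` onto `φ F` and, within `F`, respects the correspondence `φ`, i.e. maps every face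
`G ⊆ F` onto the face `φ G`. -/
def CongruentCorresponding {n : ℕ} {P Q : Set (EuclideanSpace ℝ (Fin n))}
    (φ : Face P ≃o Face Q) (F : Face P) : Prop :=
  ∃ e : EuclideanSpace ℝ (Fin n) ≃ᵃⁱ[ℝ] EuclideanSpace ℝ (Fin n),
    ∀ G : Face P, G ≤ F → e '' G.1 = (φ G).1

/-! Index the nonempty faces of Z(A) by functionals u. The proper ones come from u outside W, the
orthogonal complement of the column span, whose codimension is rank A ≥ 3. Each proper face lies in
a facet and inherits from it an isometry e_u realizing φ on its subfaces. Isometries carry centers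
of symmetry to centers, and the centers of the subfaces determine an isometry on a face
(`isometries_agree_on_face`). For u' near u the face of u' lies in that of u, so e_u' and e_u agree
on it.

Connectedness makes this global (`eq_of_eventually_eq_off_submodule`). The image of a generator aᵢ
under the linear part of e_u is locally constant for u in aᵢ^⊥ \ W, which is connected because W
still has codimension at least 2 there. Any two generators are orthogonal to a common u ∉ W, so the
images have the Gram matrix of the generators, and one linear isometry L induces them all. The
translation e_u − L is then constant in u off W. So one isometry realizes φ on all proper faces
(`exists_isometry_of_face_isometries`), and convex hulls extend this to Z(A) and Z(B). -/

open Module Filter Topology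
open scoped RealInnerProductSpace

/-- A function that is locally constant off a subspace of codimension at least two is constant
there. -/
theorem eq_of_eventually_eq_off_submodule {M Y : Type*} [NormedAddCommGroup M] [NormedSpace ℝ M]
    [FiniteDimensional ℝ M] (W : Submodule ℝ M) (hW : finrank ℝ W + 2 ≤ finrank ℝ M) (f : M → Y)
    (hf : ∀ x ∉ W, ∀ᶠ y in 𝓝 x, y ∉ W → f y = f x) {x y : M} (hx : x ∉ W) (hy : y ∉ W) :
    f x = f y := by
  -- For the discrete topology, locally constant means continuous.
  let _ : TopologicalSpace Y := ⊥
  have _ : DiscreteTopology Y := ⟨rfl⟩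
  have hrank : 1 < Module.rank ℝ (M ⧸ W) := by
    rw [← finrank_eq_rank]
    have := W.finrank_quotient_add_finrank
    exact_mod_cast (by omega : 1 < finrank ℝ (M ⧸ W))
  refine (isPathConnected_compl_of_one_lt_codim hrank).isConnected.isPreconnected.constant
    (f := f) (fun z hz => ?_) hx hy
  refine ContinuousWithinAt.congr_of_eventuallyEq (f := fun _ => f z)
    continuousWithinAt_const ?_ rfl
  exact eventually_nhdsWithin_iff.2 (hf z hz)

/-! ### Central symmetry, Gram matrices and convex hulls -/

section Center

variable {E : Type*} [NormedAddCommGroup E] [InnerProductSpace ℝ E]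

/-- A bounded set is symmetric about at most one point. -/
theorem eq_of_symmetric_of_symmetric {S : Set E} (hS : IsCompact S) (hne : S.Nonempty) {c c' : E}
    (hc : ∀ x ∈ S, (2 : ℝ) • c - x ∈ S) (hc' : ∀ x ∈ S, (2 : ℝ) • c' - x ∈ S) : c = c' := by
  -- The two reflections compose to translation by 2(c - c'), which cannot raise this maximum.
  obtain ⟨x, hx, hmax⟩ := hS.exists_isMaxOn hne
    (f := fun y => ⟪c - c', y⟫) (by fun_prop)
  have h1 := hmax (hc _ (hc' x hx))
  have h2 : (2 : ℝ) • c - ((2 : ℝ) • c' - x) = (2 : ℝ) • (c - c') + x := by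
    rw [smul_sub]; abel
  simp only [Set.mem_ofPred_eq, h2, inner_add_right, inner_smul_right] at h1
  have h3 : ⟪c - c', c - c'⟫ ≤ 0 := by linarith
  exact sub_eq_zero.1 ((real_inner_self_nonpos).1 h3)

theorem AffineIsometryEquiv.map_two_smul_sub (e : E ≃ᵃⁱ[ℝ] E) (c x : E) :
    e ((2 : ℝ) • c - x) = (2 : ℝ) • e c - e x := by
  have h1 : (2 : ℝ) • c - x = (c - x) +ᵥ c := by rw [vadd_eq_add, two_smul]; abel
  have h2 : e.linearIsometryEquiv (c - x) = e c - e x := by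
    rw [← vsub_eq_sub, ← vsub_eq_sub, e.map_vsub]
  rw [h1, e.map_vadd, h2, vadd_eq_add, two_smul]
  abel

/-- Two isometries with the same image of a compact centrally symmetric set agree at its center. -/
theorem AffineIsometryEquiv.apply_center_eq {S : Set E} (hS : IsCompact S) (hne : S.Nonempty)
    {c : E} (hc : ∀ x ∈ S, (2 : ℝ) • c - x ∈ S) (e e' : E ≃ᵃⁱ[ℝ] E) (h : e '' S = e' '' S) :
    e c = e' c := by
  refine eq_of_symmetric_of_symmetric (hS.image e.continuous) (hne.image e) ?_ ?_
  · rintro _ ⟨x, hx, rfl⟩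
    exact ⟨_, hc x hx, e.map_two_smul_sub c x⟩
  · rw [h]
    rintro _ ⟨x, hx, rfl⟩
    exact ⟨_, hc x hx, e'.map_two_smul_sub c x⟩

/-- Two families of vectors with the same Gram matrix differ by a linear isometry. -/
theorem exists_linearIsometryEquiv_of_inner_eq [FiniteDimensional ℝ E] {ι : Type*} [Fintype ι]
    (a b : ι → E) (h : ∀ i j, ⟪a i, a j⟫ = ⟪b i, b j⟫) :
    ∃ L : E ≃ₗᵢ[ℝ] E, ∀ i, L (a i) = b i := by
  let f := Fintype.linearCombination ℝ a
  let g := Fintype.linearCombination ℝ b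
  have hn : ∀ t, ‖g t‖ = ‖f t‖ := by
    intro t
    have : ⟪g t, g t⟫ = ⟪f t, f t⟫ := by
      simp only [f, g, Fintype.linearCombination_apply, sum_inner, inner_sum, real_inner_smul_left,
        real_inner_smul_right, h]
    rw [real_inner_self_eq_norm_sq, real_inner_self_eq_norm_sq] at this
    exact (sq_eq_sq₀ (norm_nonneg _) (norm_nonneg _)).1 this
  -- Every linear relation among the `a i` holds among the `b i`, so a ↦ b is well defined on the
  -- span.
  have hker : LinearMap.ker f ≤ LinearMap.ker g := by
    intro t ht
    rw [LinearMap.mem_ker] at ht ⊢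
    rw [← norm_eq_zero, hn, ht, norm_zero]
  let T : LinearMap.range f →ₗ[ℝ] E :=
    ((LinearMap.ker f).liftQ g hker).comp f.quotKerEquivRange.symm.toLinearMap
  have hT : ∀ t, T (f.rangeRestrict t) = g t := by
    intro t
    have : f.quotKerEquivRange.symm (f.rangeRestrict t) = (LinearMap.ker f).mkQ t := by
      rw [LinearEquiv.symm_apply_eq]
      rfl
    simp only [T, LinearMap.comp_apply, LinearEquiv.coe_coe, this]
    exact (LinearMap.ker f).liftQ_apply g t
  let T' : LinearMap.range f →ₗᵢ[ℝ] E := ⟨T, by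
    rintro ⟨_, t, rfl⟩
    exact (congrArg norm (hT t)).trans (hn t)⟩
  refine ⟨T'.extend.toLinearIsometryEquiv rfl, fun i => ?_⟩
  classical
  have h1 : f (Pi.single i 1) = a i := by simp [f, Fintype.linearCombination_apply_single]
  have h2 : g (Pi.single i 1) = b i := by simp [g, Fintype.linearCombination_apply_single]
  have h3 := T'.extend_apply (f.rangeRestrict (Pi.single i 1))
  have h4 : T' (f.rangeRestrict (Pi.single i 1)) = b i := (hT _).trans h2
  rw [h4] at h3
  rw [LinearIsometry.coe_toLinearIsometryEquiv, ← h3, ← h1]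
  rfl

/-- A compact convex set with a proper nonempty exposed face is the closed convex hull of its proper
nonempty exposed faces. -/
theorem subset_closure_convexHull_exposed [FiniteDimensional ℝ E] {S : Set E} (hS : IsCompact S)
    {T : Set E} (hT : (T ∩ S).Nonempty)
    (h : ∀ F : Set E, IsExposed ℝ S F → F.Nonempty → F ≠ S → F ⊆ T) :
    S ⊆ closure (convexHull ℝ T) := by
  intro x hx
  by_contra hxT
  obtain ⟨l, r, hl, hr⟩ := geometric_hahn_banach_closed_point (convex_convexHull ℝ T).closure
    isClosed_closure hxT
  have hlT : ∀ y ∈ T, l y < l x := fun y hy =>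
    (hl y (subset_closure (subset_convexHull ℝ T hy))).trans hr
  obtain ⟨z, hz, hmax⟩ := hS.exists_isMaxOn ⟨x, hx⟩ (f := l) l.continuous.continuousOn
  have hexp : IsExposed ℝ S {x ∈ S | ∀ y ∈ S, l y ≤ l x} := fun _ => ⟨l, rfl⟩
  have hzF : z ∈ {x ∈ S | ∀ y ∈ S, l y ≤ l x} := ⟨hz, fun y hy => hmax hy⟩
  by_cases hF : {x ∈ S | ∀ y ∈ S, l y ≤ l x} = S
  · obtain ⟨y, hyT, hyS⟩ := hT
    rw [← hF] at hyS
    exact absurd (hyS.2 x hx) (not_le.2 (hlT y hyT))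
  · exact absurd (hmax hx) (not_le.2 (hlT z (h _ hexp ⟨z, hzF⟩ hF hzF)))

end Center

/-! ### Faces of a zonotope, their directions and centers -/

section Zonotope

variable {E : Type*} [NormedAddCommGroup E] [InnerProductSpace ℝ E] {ι : Type*}

/-- The functional `u` is a specialization of `u'` if it has the same sign as `u'` on every generator
on which it does not vanish. -/
def SignSpecializes (a : ι → E) (u' u : E) : Prop :=
  ∀ i, (0 < ⟪u, a i⟫ → 0 < ⟪u', a i⟫) ∧ (⟪u, a i⟫ < 0 → ⟪u', a i⟫ < 0)

theorem SignSpecializes.refl (a : ι → E) (u : E) : SignSpecializes a u u :=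
  fun _ => ⟨id, id⟩

theorem SignSpecializes.trans {a : ι → E} {u v w : E} (h : SignSpecializes a u v)
    (h' : SignSpecializes a v w) : SignSpecializes a u w :=
  fun i => ⟨fun hi => (h i).1 ((h' i).1 hi), fun hi => (h i).2 ((h' i).2 hi)⟩

theorem SignSpecializes.inner_eq_zero {a : ι → E} {u v : E} (h : SignSpecializes a u v) {i : ι}
    (hi : ⟪u, a i⟫ = 0) : ⟪v, a i⟫ = 0 := by
  rcases lt_trichotomy ⟪v, a i⟫ 0 with h1 | h1 | h1
  · exact absurd hi ((h i).2 h1).ne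
  · exact h1
  · exact absurd hi ((h i).1 h1).ne'

/-- The direction of the face of a zonotope in direction `u`: the span of the generators orthogonal
to `u`. -/
def faceDirection (a : ι → E) (u : E) : Submodule ℝ E :=
  Submodule.span ℝ (a '' {i | ⟪u, a i⟫ = 0})

theorem mem_faceDirection {a : ι → E} {u : E} {i : ι} (h : ⟪u, a i⟫ = 0) :
    a i ∈ faceDirection a u :=
  Submodule.subset_span ⟨i, h, rfl⟩

theorem mem_orthogonal_span_range {a : ι → E} {u : E} :
    u ∈ (Submodule.span ℝ (Set.range a))ᗮ ↔ ∀ i, ⟪u, a i⟫ = 0 := by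
  rw [Submodule.mem_orthogonal']
  refine ⟨fun h i => h _ (Submodule.subset_span ⟨i, rfl⟩), fun h v hv => ?_⟩
  induction hv using Submodule.span_induction with
  | mem x hx => obtain ⟨i, rfl⟩ := hx; exact h i
  | zero => simp
  | add x y _ _ hx hy => rw [inner_add_right, hx, hy, add_zero]
  | smul r x _ hx => rw [real_inner_smul_right, hx, mul_zero]

variable [Fintype ι]

/-- The zonotope generated by a finite family of vectors. -/
def generatedZonotope (a : ι → E) : Set E :=
  {x | ∃ t : ι → ℝ, (∀ i, 0 ≤ t i ∧ t i ≤ 1) ∧ x = ∑ i, t i • a i}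

theorem generatedZonotope_eq_image (a : ι → E) :
    generatedZonotope a = Fintype.linearCombination ℝ a '' Set.Icc 0 1 := by
  ext x
  simp only [generatedZonotope, Set.mem_ofPred_eq, Set.mem_image, Set.mem_Icc, Pi.le_def,
    Pi.zero_apply, Pi.one_apply, Fintype.linearCombination_apply, ← forall_and]
  exact ⟨fun ⟨t, ht, hx⟩ => ⟨t, ht, hx.symm⟩, fun ⟨t, ht, hx⟩ => ⟨t, ht, hx.symm⟩⟩

theorem isCompact_generatedZonotope (a : ι → E) : IsCompact (generatedZonotope a) := by
  rw [generatedZonotope_eq_image]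
  exact isCompact_Icc.image (LinearMap.continuous_of_finiteDimensional _)

theorem convex_generatedZonotope (a : ι → E) : Convex ℝ (generatedZonotope a) := by
  rw [generatedZonotope_eq_image]
  exact (convex_Icc 0 1).linear_image _

/-- The face of a zonotope on which the functional `⟪u, ·⟫` is maximal. -/
def zonotopeFace (a : ι → E) (u : E) : Set E :=
  {x ∈ generatedZonotope a | ∀ y ∈ generatedZonotope a, ⟪u, y⟫ ≤ ⟪u, x⟫}

/-- A linear functional on the cube is maximized coordinatewise: comparison with the 0/1 point `s`
gives nonnegative terms with sum zero. -/
theorem mem_zonotopeFace_iff {a : ι → E} {u x : E} :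
    x ∈ zonotopeFace a u ↔ ∃ t : ι → ℝ, (∀ i, (0 ≤ t i ∧ t i ≤ 1) ∧
      (0 < ⟪u, a i⟫ → t i = 1) ∧ (⟪u, a i⟫ < 0 → t i = 0)) ∧ x = ∑ i, t i • a i := by
  constructor
  · rintro ⟨⟨t, ht, rfl⟩, hmax⟩
    refine ⟨t, ?_, rfl⟩
    let s : ι → ℝ := fun i => if 0 < ⟪u, a i⟫ then 1 else 0
    have hs : ∑ i, s i • a i ∈ generatedZonotope a :=
      ⟨s, fun i => by simp only [s]; split_ifs <;> norm_num, rfl⟩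
    have h1 := hmax _ hs
    simp only [inner_sum, real_inner_smul_right] at h1
    have h2 : ∀ i ∈ Finset.univ, 0 ≤ s i * ⟪u, a i⟫ - t i * ⟪u, a i⟫ := by
      intro i _
      simp only [s]
      split_ifs with h
      · nlinarith [(ht i).2]
      · nlinarith [(ht i).1]
    have h3 : ∑ i, (s i * ⟪u, a i⟫ - t i * ⟪u, a i⟫) = 0 :=
      le_antisymm (by rw [Finset.sum_sub_distrib]; linarith) (Finset.sum_nonneg h2)
    intro i
    have h4 := (Finset.sum_eq_zero_iff_of_nonneg h2).1 h3 i (Finset.mem_univ i)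
    rw [← sub_mul] at h4
    refine ⟨ht i, fun h => ?_, fun h => ?_⟩
    · have := (mul_eq_zero.1 h4).resolve_right h.ne'
      simp only [s, if_pos h] at this
      linarith
    · have := (mul_eq_zero.1 h4).resolve_right h.ne
      simp only [s, if_neg h.le.not_gt] at this
      linarith
  · rintro ⟨t, ht, rfl⟩
    refine ⟨⟨t, fun i => (ht i).1, rfl⟩, ?_⟩
    rintro _ ⟨s, hs, rfl⟩
    simp only [inner_sum, real_inner_smul_right]
    refine Finset.sum_le_sum fun i _ => ?_
    rcases lt_trichotomy ⟪u, a i⟫ 0 with h | h | h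
    · rw [(ht i).2.2 h]
      nlinarith [(hs i).1]
    · simp [h]
    · rw [(ht i).2.1 h]
      nlinarith [(hs i).2]

theorem isExposed_zonotopeFace (a : ι → E) (u : E) :
    IsExposed ℝ (generatedZonotope a) (zonotopeFace a u) :=
  fun _ => ⟨innerSL ℝ u, by simp [zonotopeFace]⟩

theorem exists_eq_zonotopeFace [CompleteSpace E] {a : ι → E} {F : Set E}
    (hF : IsExposed ℝ (generatedZonotope a) F) (hne : F.Nonempty) : ∃ u, F = zonotopeFace a u := by
  obtain ⟨l, rfl⟩ := hF hne
  refine ⟨(InnerProductSpace.toDual ℝ E).symm l, ?_⟩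
  simp [zonotopeFace]

theorem isCompact_zonotopeFace (a : ι → E) (u : E) : IsCompact (zonotopeFace a u) :=
  (isExposed_zonotopeFace a u).isCompact (isCompact_generatedZonotope a)

theorem SignSpecializes.zonotopeFace_subset {a : ι → E} {u v : E} (h : SignSpecializes a u v) :
    zonotopeFace a u ⊆ zonotopeFace a v := by
  intro x hx
  rw [mem_zonotopeFace_iff] at hx ⊢
  obtain ⟨t, ht, rfl⟩ := hx
  exact ⟨t, fun i => ⟨(ht i).1, fun hi => (ht i).2.1 ((h i).1 hi),
    fun hi => (ht i).2.2 ((h i).2 hi)⟩, rfl⟩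

theorem eventually_signSpecializes (a : ι → E) (u : E) : ∀ᶠ u' in 𝓝 u, SignSpecializes a u' u := by
  refine eventually_all.2 fun i => ?_
  have hc : Continuous fun v : E => ⟪v, a i⟫ := by fun_prop
  refine Eventually.and ?_ ?_
  · by_cases h : 0 < ⟪u, a i⟫
    · exact (hc.continuousAt.eventually (lt_mem_nhds h)).mono fun _ hv _ => hv
    · exact Eventually.of_forall fun _ hu => absurd hu h
  · by_cases h : ⟪u, a i⟫ < 0
    · exact (hc.continuousAt.eventually (gt_mem_nhds h)).mono fun _ hv _ => hv
    · exact Eventually.of_forall fun _ hu => absurd hu h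

theorem sub_mem_faceDirection {a : ι → E} {u x y : E} (hx : x ∈ zonotopeFace a u)
    (hy : y ∈ zonotopeFace a u) : x - y ∈ faceDirection a u := by
  obtain ⟨t, ht, rfl⟩ := mem_zonotopeFace_iff.1 hx
  obtain ⟨s, hs, rfl⟩ := mem_zonotopeFace_iff.1 hy
  rw [← Finset.sum_sub_distrib]
  refine Submodule.sum_mem _ fun i _ => ?_
  rw [← sub_smul]
  rcases lt_trichotomy ⟪u, a i⟫ 0 with h | h | h
  · simp [(ht i).2.2 h, (hs i).2.2 h]
  · exact Submodule.smul_mem _ _ (mem_faceDirection h)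
  · simp [(ht i).2.1 h, (hs i).2.1 h]

theorem vectorSpan_zonotopeFace (a : ι → E) (u : E) :
    vectorSpan ℝ (zonotopeFace a u) = faceDirection a u := by
  classical
  refine le_antisymm ?_ ?_
  · rw [vectorSpan_def, Submodule.span_le]
    rintro _ ⟨x, hx, y, hy, rfl⟩
    exact sub_mem_faceDirection hx hy
  · rw [faceDirection, Submodule.span_le]
    rintro _ ⟨j, hj, rfl⟩
    let s : ι → ℝ := fun i => if 0 < ⟪u, a i⟫ then 1 else 0
    have hj' : ⟪u, a j⟫ = 0 := hj
    have h1 : ∑ i, s i • a i ∈ zonotopeFace a u := by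
      refine mem_zonotopeFace_iff.2 ⟨s, fun i => ⟨?_, fun h => if_pos h,
        fun h => if_neg h.le.not_gt⟩, rfl⟩
      simp only [s]
      split_ifs <;> norm_num
    have h2 : ∑ i, (s i + (Pi.single j 1 : ι → ℝ) i) • a i ∈ zonotopeFace a u := by
      -- The coefficient `s j` is 0, so raising it to 1 stays in the face; the two points differ by
      -- `a j`.
      refine mem_zonotopeFace_iff.2 ⟨_, fun i => ?_, rfl⟩
      rcases eq_or_ne i j with rfl | hij
      · simp [s, hj']
      · simp only [Pi.single_eq_of_ne hij, add_zero]
        refine ⟨?_, fun h => if_pos h, fun h => if_neg h.le.not_gt⟩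
        simp only [s]
        split_ifs <;> norm_num
    have h3 := vsub_mem_vectorSpan ℝ h2 h1
    have h4 : ∑ i, (Pi.single j 1 : ι → ℝ) i • a i = a j := by
      rw [← Fintype.linearCombination_apply, Fintype.linearCombination_apply_single, one_smul]
    simpa only [add_smul, Finset.sum_add_distrib, vsub_eq_sub, add_sub_cancel_left, h4,
      SetLike.mem_coe] using h3

/-- The center of symmetry of a face of a zonotope. -/
noncomputable def faceCenter (a : ι → E) (u : E) : E :=
  -- Coefficients 1, 1/2, 0: the midpoints of the ranges allowed on the face.
  ∑ i, ((1 + (SignType.sign ⟪u, a i⟫ : ℝ)) / 2) • a i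

theorem faceCenter_mem (a : ι → E) (u : E) : faceCenter a u ∈ zonotopeFace a u := by
  refine mem_zonotopeFace_iff.2 ⟨_, fun i => ?_, rfl⟩
  rcases lt_trichotomy ⟪u, a i⟫ 0 with h | h | h
  · simp [sign_neg h, h.le]
  · simp [h]; norm_num
  · simp [sign_pos h, h.le]

theorem two_smul_faceCenter_sub_mem {a : ι → E} {u x : E} (hx : x ∈ zonotopeFace a u) :
    (2 : ℝ) • faceCenter a u - x ∈ zonotopeFace a u := by
  obtain ⟨t, ht, rfl⟩ := mem_zonotopeFace_iff.1 hx
  refine mem_zonotopeFace_iff.2 ⟨fun i => 1 + (SignType.sign ⟪u, a i⟫ : ℝ) - t i, fun i => ?_, ?_⟩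
  · rcases lt_trichotomy ⟪u, a i⟫ 0 with h | h | h
    · simp [sign_neg h, (ht i).2.2 h, h.le]
    · simp [h, (ht i).1]
    · simp [sign_pos h, (ht i).2.1 h, h.le]
  · rw [faceCenter, Finset.smul_sum, ← Finset.sum_sub_distrib]
    refine Finset.sum_congr rfl fun i _ => ?_
    rw [smul_smul, sub_smul, mul_div_cancel₀ _ two_ne_zero]

/-- For y orthogonal to `S`, move u slightly towards y. Only coefficients of generators orthogonal
to u change, and pairing the shift of the center with y gives half the sum of |⟪y, a i⟫| over them.
This vanishes, so y is orthogonal to the face direction. -/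
theorem faceDirection_le_of_faceCenter_sub_mem [FiniteDimensional ℝ E] {a : ι → E} {u : E}
    {S : Submodule ℝ E}
    (h : ∀ u', SignSpecializes a u' u → faceCenter a u' - faceCenter a u ∈ S) :
    faceDirection a u ≤ S := by
  rw [faceDirection, Submodule.span_le]
  rintro _ ⟨j, hj, rfl⟩
  have hj' : ⟪u, a j⟫ = 0 := hj
  rw [SetLike.mem_coe, ← S.orthogonal_orthogonal, Submodule.mem_orthogonal]
  intro y hy
  have hlim : Tendsto (fun ε : ℝ => u + ε • y) (𝓝[>] 0) (𝓝 u) := by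
    have : Continuous fun ε : ℝ => u + ε • y := by fun_prop
    simpa using (this.tendsto 0).mono_left nhdsWithin_le_nhds
  obtain ⟨ε, hε, hpos⟩ :=
    ((hlim.eventually (eventually_signSpecializes a u)).and self_mem_nhdsWithin).exists
  have hpos : 0 < ε := hpos
  have h0 := (Submodule.mem_orthogonal' S y).1 hy _ (h _ hε)
  simp only [faceCenter, ← Finset.sum_sub_distrib, ← sub_smul, inner_sum,
    real_inner_smul_right] at h0
  have hterm : ∀ i, ((1 + (SignType.sign ⟪u + ε • y, a i⟫ : ℝ)) / 2 -
      (1 + (SignType.sign ⟪u, a i⟫ : ℝ)) / 2) * ⟪y, a i⟫ =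
      if ⟪u, a i⟫ = 0 then |⟪y, a i⟫| / 2 else 0 := by
    intro i
    rcases lt_trichotomy ⟪u, a i⟫ 0 with hi | hi | hi
    · simp [sign_neg hi, sign_neg ((hε i).2 hi), hi.ne]
    · have : SignType.sign ⟪u + ε • y, a i⟫ = SignType.sign ⟪y, a i⟫ := by
        rw [inner_add_left, hi, zero_add, real_inner_smul_left, sign_mul, sign_pos hpos, one_mul]
      rw [this, if_pos hi, hi, sign_zero, ← sign_mul_self ⟪y, a i⟫, SignType.coe_zero]
      ring
    · simp [sign_pos hi, sign_pos ((hε i).1 hi), hi.ne']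
  simp only [hterm] at h0
  have := (Finset.sum_eq_zero_iff_of_nonneg (fun i _ => by split_ifs <;> positivity)).1 h0 j
    (Finset.mem_univ j)
  simpa [hj'] using this

/-- Isometries with the same images of all faces of a face of a zonotope agree on that face. -/
theorem isometries_agree_on_face [FiniteDimensional ℝ E] {a : ι → E} {u : E} {e e' : E ≃ᵃⁱ[ℝ] E}
    (h : ∀ u', SignSpecializes a u' u → e '' zonotopeFace a u' = e' '' zonotopeFace a u') :
    e (faceCenter a u) = e' (faceCenter a u) ∧
      ∀ v ∈ faceDirection a u, e.linearIsometryEquiv v = e'.linearIsometryEquiv v := by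
  have hc : ∀ u', SignSpecializes a u' u → e (faceCenter a u') = e' (faceCenter a u') :=
    fun u' hu' => AffineIsometryEquiv.apply_center_eq (isCompact_zonotopeFace a u')
      ⟨_, faceCenter_mem a u'⟩ (fun _ => two_smul_faceCenter_sub_mem) e e' (h u' hu')
  refine ⟨hc u (.refl a u), ?_⟩
  have := faceDirection_le_of_faceCenter_sub_mem (a := a) (u := u)
    (S := LinearMap.eqLocus e.linearIsometryEquiv.toLinearEquiv.toLinearMap
      e'.linearIsometryEquiv.toLinearEquiv.toLinearMap) ?_
  · exact fun v hv => this hv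
  · intro u' hu'
    change e.linearIsometryEquiv _ = e'.linearIsometryEquiv _
    rw [← vsub_eq_sub, e.map_vsub, e'.map_vsub, hc u' hu', hc u (.refl a u)]

end Zonotope

/-! ### Every proper face lies in a facet -/

section Facets

variable {E : Type*} [NormedAddCommGroup E] [InnerProductSpace ℝ E] {ι : Type*}

theorem inner_eq_zero_of_mem_faceDirection {a : ι → E} {u v : E} (hv : v ∈ faceDirection a u) :
    ⟪u, v⟫ = 0 := by
  induction hv using Submodule.span_induction with
  | mem x hx => obtain ⟨i, hi, rfl⟩ := hx; exact hi
  | zero => simp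
  | add x y _ _ hx hy => rw [inner_add_right, hx, hy, add_zero]
  | smul r x _ hx => rw [real_inner_smul_right, hx, mul_zero]

theorem faceDirection_zero (a : ι → E) :
    faceDirection a 0 = Submodule.span ℝ (Set.range a) := by
  have : {i | ⟪(0 : E), a i⟫ = 0} = Set.univ := Set.eq_univ_of_forall fun i => inner_zero_left _
  rw [faceDirection, this, Set.image_univ]

theorem faceDirection_lt {a : ι → E} {u : E}
    (hu : u ∉ (Submodule.span ℝ (Set.range a))ᗮ) :
    faceDirection a u < Submodule.span ℝ (Set.range a) := by
  refine lt_of_le_of_ne (Submodule.span_mono (Set.image_subset_range _ _)) fun h => hu ?_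
  rw [mem_orthogonal_span_range]
  exact fun i => inner_eq_zero_of_mem_faceDirection
    (h.symm ▸ Submodule.subset_span (Set.mem_range_self i))

variable [Fintype ι]

theorem generatedZonotope_eq_zonotopeFace_zero (a : ι → E) :
    generatedZonotope a = zonotopeFace a 0 := by
  simp [zonotopeFace]

theorem zonotopeFace_eq_generatedZonotope {a : ι → E} {u : E}
    (hu : u ∈ (Submodule.span ℝ (Set.range a))ᗮ) : zonotopeFace a u = generatedZonotope a := by
  rw [mem_orthogonal_span_range] at hu
  refine Set.Subset.antisymm (Set.sep_subset _ _) ?_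
  rw [generatedZonotope_eq_zonotopeFace_zero]
  exact SignSpecializes.zonotopeFace_subset fun i => by simp [hu i]

/-- A proper face of a zonotope whose dimension is too small for a facet lies in a face defined by
a functional vanishing on more generators. -/
theorem exists_signSpecializes_card_lt [FiniteDimensional ℝ E] [DecidableEq ι] {a : ι → E} {u : E}
    (hu : u ∉ (Submodule.span ℝ (Set.range a))ᗮ)
    (hdim : finrank ℝ (faceDirection a u) + 1 < finrank ℝ (Submodule.span ℝ (Set.range a))) :
    ∃ v ∉ (Submodule.span ℝ (Set.range a))ᗮ, SignSpecializes a u v ∧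
      (Finset.univ.filter fun i => ⟪v, a i⟫ ≠ 0).card <
        (Finset.univ.filter fun i => ⟪u, a i⟫ ≠ 0).card := by
  set W := (Submodule.span ℝ (Set.range a))ᗮ with hW
  -- By `hdim`, the complement of the face direction has dimension greater than dim W + 1.
  obtain ⟨y, hy, hyW⟩ : ∃ y ∈ (faceDirection a u)ᗮ, y ∉ W ⊔ Submodule.span ℝ {u} := by
    by_contra! h
    have h1 := Submodule.finrank_mono (show (faceDirection a u)ᗮ ≤ W ⊔ Submodule.span ℝ {u} from h)
    have h2 := Submodule.finrank_add_le_finrank_add_finrank W (Submodule.span ℝ {u})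
    have h3 : finrank ℝ (Submodule.span ℝ {u}) ≤ 1 := by
      simpa using finrank_span_le_card (R := ℝ) ({u} : Set E)
    have h4 := (faceDirection a u).finrank_add_finrank_orthogonal
    have h5 := (Submodule.span ℝ (Set.range a)).finrank_add_finrank_orthogonal
    rw [← hW] at h5
    omega
  have hne : (Finset.univ.filter fun i => ⟪u, a i⟫ ≠ 0).Nonempty := by
    rw [hW, mem_orthogonal_span_range] at hu
    push Not at hu
    obtain ⟨i, hi⟩ := hu
    exact ⟨i, by simpa using hi⟩
  -- With t the maximal ratio, t • u - y never has the sign opposite to u on a generator, and it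
  -- newly vanishes on `a j`.
  obtain ⟨j, hj, hmax⟩ := Finset.exists_max_image _ (fun i => ⟪y, a i⟫ / ⟪u, a i⟫) hne
  have hj : ⟪u, a j⟫ ≠ 0 := by simpa using hj
  set t := ⟪y, a j⟫ / ⟪u, a j⟫ with ht
  have hv0 : ∀ i, ⟪u, a i⟫ = 0 → ⟪t • u - y, a i⟫ = 0 := by
    intro i hi
    rw [inner_sub_left, real_inner_smul_left, hi,
      (Submodule.mem_orthogonal' _ y).1 hy _ (mem_faceDirection hi)]
    simp
  have hv : ∀ i, ⟪u, a i⟫ ≠ 0 →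
      ⟪t • u - y, a i⟫ = (t - ⟪y, a i⟫ / ⟪u, a i⟫) * ⟪u, a i⟫ := by
    intro i hi
    rw [inner_sub_left, real_inner_smul_left, sub_mul, div_mul_cancel₀ _ hi]
  have hnn : ∀ i, ⟪u, a i⟫ ≠ 0 → 0 ≤ t - ⟪y, a i⟫ / ⟪u, a i⟫ := fun i hi =>
    sub_nonneg.2 (hmax i (by simpa using hi))
  refine ⟨t • u - y, fun h => hyW ?_, fun i => ?_, ?_⟩
  · have : y = -(t • u - y) + t • u := by abel
    rw [this]
    exact Submodule.add_mem_sup (W.neg_mem h)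
      (Submodule.smul_mem _ _ (Submodule.mem_span_singleton_self u))
  · by_cases hi : ⟪u, a i⟫ = 0
    · rw [hv0 i hi]
      exact ⟨fun h => absurd h (lt_irrefl _), fun h => absurd h (lt_irrefl _)⟩
    · rw [hv i hi]
      exact ⟨fun h => pos_of_mul_pos_right h (hnn i hi),
        fun h => neg_of_mul_neg_right h (hnn i hi)⟩
  · refine Finset.card_lt_card (Finset.ssubset_iff_of_subset ?_ |>.2 ⟨j, by simpa using hj, ?_⟩)
    · intro i hi
      simp only [Finset.mem_filter, Finset.mem_univ, true_and] at hi ⊢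
      exact fun h => hi (hv0 i h)
    · simp only [Finset.mem_filter, Finset.mem_univ, true_and, not_not]
      rw [hv j hj, ← ht, sub_self, zero_mul]

/-- Every proper face of a zonotope lies in a facet. -/
theorem exists_facet_signSpecializes [FiniteDimensional ℝ E] {a : ι → E} {u : E}
    (hu : u ∉ (Submodule.span ℝ (Set.range a))ᗮ) :
    ∃ v, SignSpecializes a u v ∧
      finrank ℝ (faceDirection a v) + 1 = finrank ℝ (Submodule.span ℝ (Set.range a)) := by
  classical
  induction hm : (Finset.univ.filter fun i => ⟪u, a i⟫ ≠ 0).card using Nat.strong_induction_on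
    generalizing u with
  | _ m ih =>
    have hlt := Submodule.finrank_lt_finrank_of_lt (faceDirection_lt hu)
    rcases (Nat.succ_le_of_lt hlt).eq_or_lt with h | h
    · exact ⟨u, .refl a u, h⟩
    · obtain ⟨v, hvW, huv, hcard⟩ := exists_signSpecializes_card_lt hu h
      obtain ⟨w, hvw, hw⟩ := ih _ (hm ▸ hcard) hvW rfl
      exact ⟨w, huv.trans hvw, hw⟩

end Facets

/-! ### Gluing the isometries of the faces -/

section Rigidity

variable {E : Type*} [NormedAddCommGroup E] [InnerProductSpace ℝ E] [FiniteDimensional ℝ E]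
  {ι : Type*} [Fintype ι]

/-- If the proper faces of a zonotope of dimension at least three are moved by isometries that are
compatible on common subfaces, then a single isometry moves all of them. -/
theorem exists_isometry_of_face_isometries {a : ι → E}
    (hrank : 3 ≤ finrank ℝ (Submodule.span ℝ (Set.range a))) {Φ : E → Set E}
    (h : ∀ u ∉ (Submodule.span ℝ (Set.range a))ᗮ, ∃ e : E ≃ᵃⁱ[ℝ] E, ∀ u',
      SignSpecializes a u' u → e '' zonotopeFace a u' = Φ u') :
    ∃ e : E ≃ᵃⁱ[ℝ] E, ∀ u ∉ (Submodule.span ℝ (Set.range a))ᗮ, e '' zonotopeFace a u = Φ u := by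
  have hW := (Submodule.span ℝ (Set.range a)).finrank_add_finrank_orthogonal
  have hWmem := fun u => mem_orthogonal_span_range (a := a) (u := u)
  generalize (Submodule.span ℝ (Set.range a))ᗮ = W at h hW hWmem ⊢
  choose! e he using h
  have hlin : ∀ u ∉ W, ∀ᶠ u' in 𝓝 u, u' ∉ W → SignSpecializes a u' u ∧
      e u' (faceCenter a u') = e u (faceCenter a u') ∧
        ∀ v ∈ faceDirection a u', (e u').linearIsometryEquiv v = (e u).linearIsometryEquiv v := by
    intro u hu
    filter_upwards [eventually_signSpecializes a u] with u' hu' hu'W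
    refine ⟨hu', isometries_agree_on_face fun w hw => ?_⟩
    rw [he u' hu'W w hw, he u hu w (hw.trans hu')]
  have hconst : ∀ i, ∀ u ∉ W, ∀ v ∉ W, ⟪u, a i⟫ = 0 → ⟪v, a i⟫ = 0 →
      (e u).linearIsometryEquiv (a i) = (e v).linearIsometryEquiv (a i) := by
    intro i u hu v hv hui hvi
    -- dim M ≥ dim E - 1 and dim W ≤ dim E - 3, so W has codimension at least 2 in M.
    let M := (Submodule.span ℝ {a i})ᗮ
    have hM : ∀ {w}, w ∈ M ↔ ⟪w, a i⟫ = 0 := Submodule.mem_orthogonal_singleton_iff_inner_left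
    have hM1 : finrank ℝ (Submodule.span ℝ {a i}) ≤ 1 := by
      simpa using finrank_span_le_card (R := ℝ) ({a i} : Set E)
    have hM2 := (Submodule.span ℝ {a i}).finrank_add_finrank_orthogonal
    have hM3 : finrank ℝ (W.comap M.subtype) ≤ finrank ℝ W := by
      rw [← Submodule.finrank_map_subtype_eq M]
      exact Submodule.finrank_mono (Submodule.map_comap_le _ _)
    have hM4 : finrank ℝ M = finrank ℝ (Submodule.span ℝ {a i})ᗮ := rfl
    refine eq_of_eventually_eq_off_submodule (M := M) (W.comap M.subtype) (by omega)
      (fun w => (e w).linearIsometryEquiv (a i)) ?_ (x := ⟨u, hM.2 hui⟩) (y := ⟨v, hM.2 hvi⟩) hu hv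
    intro w hw
    have := continuous_subtype_val.continuousAt.eventually (hlin w hw)
    filter_upwards [this] with w' hw' hw'W
    exact (hw' hw'W).2.2 _ (mem_faceDirection (hM.1 w'.2))
  -- The complement of two vectors has dimension at least dim E - 2 > dim W.
  have hex : ∀ i j, ∃ u ∉ W, ⟪u, a i⟫ = 0 ∧ ⟪u, a j⟫ = 0 := by
    classical
    intro i j
    have h1 := (Submodule.span ℝ {a i, a j}).finrank_add_finrank_orthogonal
    have h2 : finrank ℝ (Submodule.span ℝ {a i, a j}) ≤ 2 := by
      refine (finrank_span_le_card (R := ℝ) ({a i, a j} : Set E)).trans ?_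
      simpa using Finset.card_le_two (a := a i) (b := a j)
    obtain ⟨u, hu, huW⟩ : ∃ u ∈ (Submodule.span ℝ {a i, a j})ᗮ, u ∉ W := by
      by_contra! hle
      have := Submodule.finrank_mono (show (Submodule.span ℝ {a i, a j})ᗮ ≤ W from hle)
      omega
    rw [Submodule.mem_orthogonal'] at hu
    exact ⟨u, huW, hu _ (Submodule.subset_span (by simp)), hu _ (Submodule.subset_span (by simp))⟩
  choose p hp hpi _ using fun i => hex i i
  obtain ⟨L, hL⟩ := exists_linearIsometryEquiv_of_inner_eq a
    (fun i => (e (p i)).linearIsometryEquiv (a i)) fun i j => by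
      obtain ⟨u, hu, hui, huj⟩ := hex i j
      rw [hconst i _ (hp i) u hu (hpi i) hui, hconst j _ (hp j) u hu (hpi j) huj,
        LinearIsometryEquiv.inner_map_map]
  have hLe : ∀ u ∉ W, ∀ v ∈ faceDirection a u, (e u).linearIsometryEquiv v = L v := by
    intro u hu v hv
    induction hv using Submodule.span_induction with
    | mem x hx => obtain ⟨i, hi, rfl⟩ := hx; rw [hL, hconst i _ (hp i) u hu (hpi i) hi]
    | zero => simp
    | add x y _ _ hx hy => rw [map_add, map_add, hx, hy]
    | smul r x _ hx => rw [map_smul, map_smul, hx]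
  -- On each face `e u` is L followed by a translation; `hκ` shows that the translation does not
  -- depend on u.
  have hLe' : ∀ u ∉ W, ∀ x ∈ zonotopeFace a u, ∀ y ∈ zonotopeFace a u,
      e u x - L x = e u y - L y := by
    intro u hu x hx y hy
    have h1 := hLe u hu _ (sub_mem_faceDirection hx hy)
    have h2 := (e u).map_vsub x y
    simp only [vsub_eq_sub] at h2
    rw [h2, map_sub] at h1
    exact sub_eq_sub_iff_sub_eq_sub.2 h1
  have hκ : ∀ u ∉ W, ∀ v ∉ W,
      e u (faceCenter a u) - L (faceCenter a u) = e v (faceCenter a v) - L (faceCenter a v) := by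
    intro u hu v hv
    refine eq_of_eventually_eq_off_submodule W (by omega)
      (fun w => e w (faceCenter a w) - L (faceCenter a w)) ?_ hu hv
    intro w hw
    filter_upwards [hlin w hw] with w' hw' hw'W
    obtain ⟨hs, hc, -⟩ := hw' hw'W
    rw [hc]
    exact hLe' w hw _ (hs.zonotopeFace_subset (faceCenter_mem a w')) _ (faceCenter_mem a w)
  by_cases hne : ∃ u, u ∉ W
  · obtain ⟨v, hv⟩ := hne
    refine ⟨L.toAffineIsometryEquiv.trans (AffineIsometryEquiv.constVAdd ℝ E
      (e v (faceCenter a v) - L (faceCenter a v))), fun u hu => ?_⟩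
    rw [← he u hu u (.refl a u)]
    refine Set.image_congr fun x hx => ?_
    have h1 := (hLe' u hu x hx _ (faceCenter_mem a u)).trans (hκ u hu v hv)
    simp [← h1]
  · push Not at hne
    exact ⟨.refl ℝ E, fun u hu => absurd (hne u) hu⟩

end Rigidity

/-! ### The proposition for matrices -/

theorem finrank_span_range_toLp_col {n k : ℕ} (A : Matrix (Fin n) (Fin k) ℝ) :
    finrank ℝ (Submodule.span ℝ (Set.range fun i => WithLp.toLp 2 (A.col i))) = A.rank := by
  rw [Matrix.rank_eq_finrank_span_cols,
    ← LinearEquiv.finrank_map_eq (WithLp.linearEquiv 2 ℝ (Fin n → ℝ)).symm, Submodule.map_span,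
    ← Set.range_comp]
  rfl

theorem proposition3p8 {n k l : ℕ} (A : Matrix (Fin n) (Fin k) ℝ) (B : Matrix (Fin n) (Fin l) ℝ)
    (hA : 3 ≤ A.rank)
    (φ : Face (zonotope A) ≃o Face (zonotope B))
    (hφ : ∀ F : Face (zonotope A), IsFacet F → CongruentCorresponding φ F) :
    CongruentSets (zonotope A) (zonotope B) := by
  let a : Fin k → EuclideanSpace ℝ (Fin n) := fun i => WithLp.toLp 2 (A.col i)
  have hrank : 3 ≤ finrank ℝ (Submodule.span ℝ (Set.range a)) := by
    rwa [finrank_span_range_toLp_col]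
  have hZB : zonotope B = generatedZonotope fun i => WithLp.toLp 2 (B.col i) := rfl
  have hBc : IsCompact (zonotope B) := hZB ▸ isCompact_generatedZonotope _
  have hBv : Convex ℝ (zonotope B) := hZB ▸ convex_generatedZonotope _
  let face (u : EuclideanSpace ℝ (Fin n)) : Face (zonotope A) :=
    ⟨zonotopeFace a u, isExposed_zonotopeFace a u⟩
  have hfacet : ∀ u ∉ (Submodule.span ℝ (Set.range a))ᗮ,
      ∃ e : EuclideanSpace ℝ (Fin n) ≃ᵃⁱ[ℝ] EuclideanSpace ℝ (Fin n), ∀ u',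
        SignSpecializes a u' u → e '' zonotopeFace a u' = (φ (face u')).1 := by
    intro u hu
    -- The isometry of a facet containing the face of u also serves all subfaces of that face.
    obtain ⟨v, huv, hv⟩ := exists_facet_signSpecializes hu
    obtain ⟨e, he⟩ := hφ (face v) ⟨⟨_, faceCenter_mem a v⟩, by
      change affDim (zonotopeFace a v) + 1 = affDim (generatedZonotope a)
      rw [affDim, affDim, generatedZonotope_eq_zonotopeFace_zero, vectorSpan_zonotopeFace,
        vectorSpan_zonotopeFace, hv, faceDirection_zero]⟩
    exact ⟨e, fun u' hu' => he (face u') (hu'.trans huv).zonotopeFace_subset⟩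
  obtain ⟨e, he⟩ := exists_isometry_of_face_isometries hrank hfacet
  have hproper : ∀ F : Set (EuclideanSpace ℝ (Fin n)), IsExposed ℝ (zonotope A) F → F.Nonempty →
      F ≠ zonotope A → ∃ u ∉ (Submodule.span ℝ (Set.range a))ᗮ, F = zonotopeFace a u := by
    intro F hF hne hFA
    obtain ⟨u, rfl⟩ := exists_eq_zonotopeFace (a := a) hF hne
    exact ⟨u, fun hu => hFA (zonotopeFace_eq_generatedZonotope hu), rfl⟩
  obtain ⟨u₀, hu₀⟩ : ∃ u, u ∉ (Submodule.span ℝ (Set.range a))ᗮ := by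
    by_contra! hall
    have h1 := (Submodule.span ℝ (Set.range a)).finrank_add_finrank_orthogonal
    rw [(Submodule.eq_top_iff' (p := (Submodule.span ℝ (Set.range a))ᗮ)).2 hall,
      finrank_top] at h1
    omega
  have hAconv : zonotope A ⊆ closure (convexHull ℝ (zonotope A ∩ e ⁻¹' zonotope B)) := by
    have hsub : ∀ u ∉ (Submodule.span ℝ (Set.range a))ᗮ,
        zonotopeFace a u ⊆ zonotope A ∩ e ⁻¹' zonotope B := fun u hu x hx =>
      ⟨hx.1, (φ (face u)).2.subset (he u hu ▸ Set.mem_image_of_mem e hx)⟩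
    refine subset_closure_convexHull_exposed (isCompact_generatedZonotope a)
      ⟨faceCenter a u₀, hsub u₀ hu₀ (faceCenter_mem a u₀), (faceCenter_mem a u₀).1⟩ ?_
    intro F hF hne hFA
    obtain ⟨u, hu, rfl⟩ := hproper F hF hne hFA
    exact hsub u hu
  have hBconv : zonotope B ⊆ closure (convexHull ℝ (zonotope B ∩ e '' zonotope A)) := by
    have hmem : ∀ u ∉ (Submodule.span ℝ (Set.range a))ᗮ,
        (φ (face u)).1 ⊆ zonotope B ∩ e '' zonotope A := by
      intro u hu x hx
      refine ⟨(φ (face u)).2.subset hx, ?_⟩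
      rw [← he u hu] at hx
      exact Set.image_mono (Set.sep_subset _ _) hx
    have hx₀ : e (faceCenter a u₀) ∈ (φ (face u₀)).1 :=
      he u₀ hu₀ ▸ Set.mem_image_of_mem e (faceCenter_mem a u₀)
    refine subset_closure_convexHull_exposed hBc
      ⟨_, hmem u₀ hu₀ hx₀, (hmem u₀ hu₀ hx₀).1⟩ ?_
    intro G hG hne hGB
    obtain ⟨F, hF⟩ := φ.surjective ⟨G, hG⟩
    -- An order isomorphism preserves the bottom ∅ and the top, so a proper nonempty face of Z(B)
    -- comes from one of Z(A).
    have hFne : F.1.Nonempty := by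
      by_contra hF0
      rw [Set.not_nonempty_iff_eq_empty] at hF0
      have hle : F ≤ φ.symm ⟨∅, isExposed_empty⟩ := by
        change F.1 ⊆ _
        simp [hF0]
      have hle' : G ⊆ ∅ := by
        have := φ.monotone hle
        rw [φ.apply_symm_apply, hF] at this
        exact this
      exact hne.ne_empty (Set.subset_empty_iff.1 hle')
    have hFA : F.1 ≠ zonotope A := by
      intro hF1
      have hle : φ.symm ⟨zonotope B, .refl _⟩ ≤ F := by
        change _ ⊆ F.1
        rw [hF1]
        exact (φ.symm _).2.subset
      have hle' : zonotope B ⊆ G := by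
        have := φ.monotone hle
        rw [φ.apply_symm_apply, hF] at this
        exact this
      exact hGB (hG.subset.antisymm hle')
    obtain ⟨u, hu, hFu⟩ := hproper F.1 F.2 hFne hFA
    have : F = face u := Subtype.ext hFu
    have hGu : G = (φ (face u)).1 := by rw [← this, hF]
    exact hGu ▸ hmem u hu
  -- Z(B) and e(Z(A)) are closed and convex, so inclusions of the proper faces pass to closed convex
  -- hulls.
  refine ⟨e, Set.Subset.antisymm ?_ ?_⟩
  · rw [Set.image_subset_iff]
    refine hAconv.trans (closure_minimal (convexHull_min Set.inter_subset_right ?_) ?_)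
    · exact hBv.affine_preimage e.toAffineEquiv.toAffineMap
    · exact hBc.isClosed.preimage e.continuous
  · refine hBconv.trans (closure_minimal (convexHull_min Set.inter_subset_right ?_) ?_)
    · exact (convex_generatedZonotope a).affine_image e.toAffineEquiv.toAffineMap
    · exact ((isCompact_generatedZonotope a).image e.continuous).isClosed
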